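/- Let $R$ be a commutative Noetherian ring with $1$. For each maximal ideal $\mathfrak m$ of $R$ let $E(R/\mathfrak m)$ denote the injective envelope of the $R$-module $R/\mathfrak m$ (an injective module that is an essential extension of $R/\mathfrak m$), and let $n_{\mathfrak m}$ be a nonnegative integer. Put $$E=\bigoplus_{\mathfrak m}\Bigl(\bigoplus_{n_{\mathfrak m}}E(R/\mathfrak m)\Bigr),$$ where $\mathfrak m$ runs over all maximal ideals of $R$ and the inner sum consists of $n_{\mathfrak m}$ copies of $E(R/\mathfrak m)$. Then every $R$-submodule $M$ of $E$ is co-Hopfian, that is, every injective $R$-module endomorphism of $M$ is an automorphism. -/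

import Mathlib

open scoped DirectSum

universe u v w

/-- A module `M` is *co-Hopfian* if every monic (that is, injective) `R`-linear endomorphism of `M`
is an automorphism. -/
def IsCoHopfian (R : Type u) [Ring R] (M : Type v) [AddCommGroup M] [Module R M] : Prop :=
  ∀ f : M →ₗ[R] M, Function.Injective f → Function.Bijective f

/-- `i : M → E` exhibits `E` as an *injective envelope* `E(M)` of `M`: the module `E` is injective
and `i` is an essential monomorphism. The smallness assumption (automatic when `E` lives in the
universe of `R` or in a larger one) guarantees that `Module.Injective R E`, which tests against
modules in the universe of `E`, is injectivity against all modules. -/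
structure IsInjectiveEnvelope (R : Type u) [Ring R] {M : Type w} [AddCommGroup M] [Module R M]
    {E : Type v} [AddCommGroup E] [Module R E] [Small.{v} R] (i : M →ₗ[R] E) : Prop where
  injective_module : Module.Injective R E
  injective : Function.Injective i
  essential : ∀ N : Submodule R E, N ⊓ LinearMap.range i = ⊥ → N = ⊥

/-- Inside an injective module, every submodule has an injective essential extension. -/
theorem exists_essential_injective_submodule {R : Type u} [Ring R] [Small.{v} R] {Q : Type v}
    [AddCommGroup Q] [Module R Q] [hQ : Module.Injective R Q] (A : Submodule R Q) :
    ∃ N : Submodule R Q, A ≤ N ∧ (∀ x ∈ N, x ≠ 0 → ∃ r : R, r • x ∈ A ∧ r • x ≠ 0) ∧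
      Module.Injective R N := by
  obtain ⟨N, hAN, ⟨-, hNess⟩, hNmax⟩ := zorn_le_nonempty₀
    {N : Submodule R Q | A ≤ N ∧ ∀ x ∈ N, x ≠ 0 → ∃ r : R, r • x ∈ A ∧ r • x ≠ 0}
    (by
      intro c hc hchain y hy
      refine ⟨sSup c, ⟨(hc hy).1.trans (le_sSup hy), ?_⟩, fun z hz => le_sSup hz⟩
      intro x hx hx0
      obtain ⟨P, hP, hxP⟩ := (Submodule.mem_sSup_of_directed ⟨y, hy⟩ hchain.directedOn).1 hx
      exact (hc hP).2 x hxP hx0)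
    A ⟨le_rfl, fun x hx hx0 => ⟨1, by simpa using hx, by simpa using hx0⟩⟩
  refine ⟨N, hAN, hNess, ?_⟩
  obtain ⟨K, -, hKN, hKmax⟩ := zorn_le_nonempty₀ {K : Submodule R Q | Disjoint N K}
    (by
      intro c hc hchain y hy
      exact ⟨sSup c, hchain.directedOn.disjoint_sSup_right.2 (fun {z} hz => hc hz),
        fun z hz => le_sSup hz⟩)
    ⊥ disjoint_bot_right
  have hKN' : Disjoint N K := hKN
  have hinj : Function.Injective (K.mkQ ∘ₗ N.subtype) := by
    rw [← LinearMap.ker_eq_bot, LinearMap.ker_eq_bot']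
    intro n hn
    have hnK : (n : Q) ∈ K := by simpa using hn
    exact Subtype.ext (Submodule.disjoint_def.1 hKN' n n.2 hnK)
  obtain ⟨h, hh⟩ := hQ.out (K.mkQ ∘ₗ N.subtype) hinj N.subtype
  have hh' : ∀ n ∈ N, h (K.mkQ n) = n := fun n hn => hh ⟨n, hn⟩
  have hker : ∀ z, h (K.mkQ z) = 0 → z ∈ K := by
    have hle : K ≤ LinearMap.ker (h ∘ₗ K.mkQ) := by
      intro k hk
      have : K.mkQ k = 0 := by simpa using hk
      simp only [LinearMap.mem_ker, LinearMap.comp_apply, this, map_zero]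
    have hdis : Disjoint N (LinearMap.ker (h ∘ₗ K.mkQ)) := by
      rw [Submodule.disjoint_def]
      intro n hn hn'
      rw [← hh' n hn]
      exact hn'
    exact fun z hz => hKmax hdis hle hz
  have hrange : ∀ z, h (K.mkQ z) ∈ N := by
    have hle : N ≤ LinearMap.range (h ∘ₗ K.mkQ) := fun n hn => ⟨n, hh' n hn⟩
    have hmem : A ≤ LinearMap.range (h ∘ₗ K.mkQ) ∧ ∀ x ∈ LinearMap.range (h ∘ₗ K.mkQ), x ≠ 0 →
        ∃ r : R, r • x ∈ A ∧ r • x ≠ 0 := by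
      refine ⟨hAN.trans hle, ?_⟩
      rintro _ ⟨z, rfl⟩ hz0
      have hzK : z ∉ K := by
        intro hz
        have : K.mkQ z = 0 := by simpa using hz
        exact hz0 (by simp only [LinearMap.comp_apply, this, map_zero])
      have hnd : ¬ Disjoint N (K ⊔ Submodule.span R {z}) := fun hd =>
        hzK (hKmax hd le_sup_left
          (le_sup_right (a := K) (Submodule.mem_span_singleton_self z)))
      rw [Submodule.disjoint_def] at hnd
      push Not at hnd
      obtain ⟨n, hn, hn', hn0⟩ := hnd
      obtain ⟨k, hk, s, hs, hks⟩ := Submodule.mem_sup.1 hn'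
      obtain ⟨r, rfl⟩ := Submodule.mem_span_singleton.1 hs
      have hk0 : K.mkQ k = 0 := by simpa using hk
      have hrz : r • (h ∘ₗ K.mkQ) z = n := by
        rw [← hh' n hn, ← hks, map_add, hk0, zero_add, map_smul, map_smul, LinearMap.comp_apply]
      obtain ⟨t, htA, ht0⟩ := hNess n hn hn0
      exact ⟨t * r, by rwa [mul_smul, hrz], by rwa [mul_smul, hrz]⟩
    exact fun z => hNmax hmem hle ⟨z, rfl⟩
  refine ⟨fun X Y _ _ _ _ f hf g => ?_⟩
  obtain ⟨e, he⟩ := hQ.out f hf (N.subtype ∘ₗ g)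
  refine ⟨(LinearMap.codRestrict N (h ∘ₗ K.mkQ) hrange) ∘ₗ e, fun x => Subtype.ext ?_⟩
  change h (K.mkQ (e (f x))) = _
  rw [he]
  exact hh' _ (g x).2

/-- Every module has an injective envelope. -/
theorem exists_isInjectiveEnvelope (R : Type u) [Ring R] [Small.{v} R] (M : Type v)
    [AddCommGroup M] [Module R M] :
    ∃ (E : Type v) (_ : AddCommGroup E) (_ : Module R E) (i : M →ₗ[R] E),
      IsInjectiveEnvelope R i := by
  obtain ⟨⟨Q, hQinj, j, hj⟩⟩ :=
    CategoryTheory.EnoughInjectives.presentation (ModuleCat.of R M)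
  have : Module.Injective R Q := (Module.injective_iff_injective_object R Q).2 hQinj
  have hj' : Function.Injective j.hom := (ModuleCat.mono_iff_injective j).1 hj
  obtain ⟨N, hAN, hess, hN⟩ := exists_essential_injective_submodule (LinearMap.range j.hom)
  refine ⟨N, inferInstance, inferInstance,
    LinearMap.codRestrict N j.hom (fun x => hAN ⟨x, rfl⟩), hN, ?_, ?_⟩
  · intro x y hxy
    exact hj' (congrArg Subtype.val hxy)
  · intro P hP
    rw [Submodule.eq_bot_iff]
    intro x hx
    by_contra hx0
    obtain ⟨r, ⟨m, hm⟩, hr0⟩ := hess x x.2 (fun h => hx0 (Subtype.ext h))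
    have hmem : r • x ∈ P ⊓ LinearMap.range
        (LinearMap.codRestrict N j.hom (fun x => hAN ⟨x, rfl⟩)) :=
      ⟨P.smul_mem r hx, m, Subtype.ext hm⟩
    rw [hP, Submodule.mem_bot] at hmem
    exact hr0 (congrArg Subtype.val hmem)

/-! An injective endomorphism `f` of `M` maps the `I`-torsion of `M` into itself for every ideal
`I`, and is bijective there once that torsion is Artinian. So it suffices that `M` is a union of
Artinian torsion submodules. Noetherianity makes each element of `E(R/m)` killed by a power of `m`,
so each element of `M` is killed by a product of maximal ideals. The `m`-torsion of `M` embeds in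
`(R/m)^(n m)`, because `E(R/m)` has socle `R/m` and the other envelopes have no `m`-torsion;
extensions then pass from `m` to products. -/

namespace IsInjectiveEnvelope

variable {R : Type u} {M : Type w} {E : Type v} [AddCommGroup M] [AddCommGroup E]

/-- A nonzero element of an injective envelope has a nonzero multiple in the base module. -/
theorem exists_smul_mem_range [Ring R] [Module R M] [Module R E] [Small.{v} R] {i : M →ₗ[R] E}
    (hi : IsInjectiveEnvelope R i) {x : E} (hx : x ≠ 0) :
    ∃ r : R, r • x ∈ LinearMap.range i ∧ r • x ≠ 0 := by
  by_contra! h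
  refine hx (Submodule.span_singleton_eq_bot.1 (hi.essential (R ∙ x) ?_))
  rw [Submodule.eq_bot_iff]
  rintro y ⟨hy, hy'⟩
  obtain ⟨r, rfl⟩ := Submodule.mem_span_singleton.1 hy
  exact h r hy'

variable [CommRing R] [Module R E] {m : Ideal R} {i : (R ⧸ m) →ₗ[R] E}

theorem _root_.LinearMap.smul_eq_zero_of_mem_range_quotient {y : E} (hy : y ∈ LinearMap.range i)
    {a : R} (ha : a ∈ m) : a • y = 0 := by
  obtain ⟨q, rfl⟩ := hy
  obtain ⟨b, rfl⟩ := Ideal.Quotient.mk_surjective q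
  rw [← map_smul, ← map_zero i]
  congr 1
  exact Ideal.Quotient.eq_zero_iff_mem.2 (m.mul_mem_right b ha)

variable [Small.{v} R]

/-- The socle of `E(R/m)` is `R/m`. -/
theorem mem_range_of_forall_smul_eq_zero [m.IsMaximal] (hi : IsInjectiveEnvelope R i) {x : E}
    (hx : ∀ a ∈ m, a • x = 0) : x ∈ LinearMap.range i := by
  by_cases hx0 : x = 0
  · exact hx0 ▸ zero_mem _
  obtain ⟨r, hr, hr0⟩ := hi.exists_smul_mem_range hx0
  have hrm : r ∉ m := fun h => hr0 (hx r h)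
  obtain ⟨s, a, ha, hsa⟩ := Ideal.IsMaximal.exists_inv ‹_› hrm
  have : x = s • r • x := by
    conv_lhs => rw [← one_smul R x, ← hsa, add_smul, hx a ha, add_zero, mul_smul]
  rw [this]
  exact Submodule.smul_mem _ s hr

/-- For a maximal ideal `m' ≠ m`, the module `E(R/m)` has no nonzero element killed by `m'`. -/
theorem eq_zero_of_forall_smul_eq_zero (hm : m.IsMaximal) {m' : Ideal R} (hm' : m'.IsMaximal)
    (hne : m' ≠ m) (hi : IsInjectiveEnvelope R i) {x : E} (hx : ∀ a ∈ m', a • x = 0) : x = 0 := by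
  by_contra hx0
  obtain ⟨r, hr, hr0⟩ := hi.exists_smul_mem_range hx0
  -- `r • x` is killed by both `m'` and `m`, hence by `1 = a + b`.
  obtain ⟨a, ha, b, hb, hab⟩ := Submodule.mem_sup.1
    ((Ideal.eq_top_iff_one _).1 (Ideal.IsMaximal.coprime_of_ne hm' hm hne))
  apply hr0
  rw [← one_smul R (r • x), ← hab, add_smul, smul_comm, hx a ha, smul_zero, zero_add,
    LinearMap.smul_eq_zero_of_mem_range_quotient hr hb]

/-- Over a Noetherian ring, every element of `E(R/m)` is killed by a power of `m`. -/
theorem exists_pow_smul_eq_zero [IsNoetherianRing R] (hi : IsInjectiveEnvelope R i) (x : E) :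
    ∃ k : ℕ, ∀ a ∈ m ^ k, a • x = 0 := by
  have hrad : m ≤ Ideal.radical (LinearMap.ker (LinearMap.toSpanSingleton R E x)) := by
    intro a ha
    -- The annihilators of `a ^ k • x` ascend, so they stabilise. If `a ^ k • x ≠ 0`, some nonzero
    -- multiple of it lies in the copy of `R/m` and is killed by `a`, contradicting stability.
    let A : ℕ →o Ideal R :=
      ⟨fun k => LinearMap.ker (LinearMap.toSpanSingleton R E (a ^ k • x)),
        monotone_nat_of_le_succ fun k r hr => by
          simp only [LinearMap.mem_ker, LinearMap.toSpanSingleton_apply] at hr ⊢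
          rw [pow_succ', mul_smul, smul_comm, hr, smul_zero]⟩
    obtain ⟨k, hk⟩ := monotone_stabilizes_iff_noetherian.2 ‹IsNoetherianRing R› A
    refine ⟨k, ?_⟩
    change a ^ k • x = 0
    by_contra h0
    obtain ⟨r, hr, hr0⟩ := hi.exists_smul_mem_range h0
    have hmem : r ∈ A (k + 1) := by
      change r • a ^ (k + 1) • x = 0
      rw [pow_succ', mul_smul, smul_comm, LinearMap.smul_eq_zero_of_mem_range_quotient hr ha]
    rw [← hk (k + 1) k.le_succ] at hmem
    exact hr0 hmem
  obtain ⟨k, hk⟩ := Ideal.exists_pow_le_of_le_radical_of_fg hrad (IsNoetherian.noetherian m)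
  exact ⟨k, fun a ha => hk ha⟩

end IsInjectiveEnvelope

section Torsion

variable {R : Type u} [CommRing R] {X : Type v} [AddCommGroup X] [Module R X]

/-- Multiplication by the finitely many generators of `I` maps the `I * J`-torsion to a finite power
of the `J`-torsion, with kernel inside the `I`-torsion. -/
theorem Submodule.isArtinian_torsionBySet_mul {I J : Ideal R} (hI : I.FG)
    [IsArtinian R (torsionBySet R X I)] [IsArtinian R (torsionBySet R X J)] :
    IsArtinian R (torsionBySet R X ((I * J : Ideal R) : Set R)) := by
  obtain ⟨s, rfl⟩ := hI
  let g : torsionBySet R X ((Ideal.span (s : Set R) * J : Ideal R) : Set R) →ₗ[R]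
      (s → torsionBySet R X (J : Set R)) :=
    LinearMap.pi fun a => LinearMap.codRestrict _
      (LinearMap.lsmul R X a ∘ₗ Submodule.subtype _) fun x => by
        rw [mem_torsionBySet_iff]
        rintro ⟨b, hb⟩
        have := (mem_torsionBySet_iff _ _).1 x.2
          ⟨a * b, Ideal.mul_mem_mul (Ideal.subset_span a.2) hb⟩
        simpa [Submonoid.smul_def, mul_smul, smul_comm b] using this
  have hker : ∀ x : LinearMap.ker g, (torsionBySet R X _).subtype ((LinearMap.ker g).subtype x) ∈
      torsionBySet R X ((Ideal.span (s : Set R) : Ideal R) : Set R) := by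
    rintro ⟨x, hx⟩
    rw [← torsionBySet_eq_torsionBySet_span, mem_torsionBySet_iff]
    intro a
    exact congrArg Subtype.val (congrFun (LinearMap.mem_ker.1 hx) a)
  have : IsArtinian R (LinearMap.ker g) :=
    isArtinian_of_injective
      (LinearMap.codRestrict (torsionBySet R X ((Ideal.span (s : Set R) : Ideal R) : Set R))
        ((torsionBySet R X _).subtype ∘ₗ (LinearMap.ker g).subtype) hker)
      fun x y hxy => Subtype.ext (Subtype.ext
        (by simpa using congrArg (Submodule.subtype _) hxy))
  exact isArtinian_of_range_eq_ker (LinearMap.ker g).subtype g (by simp)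

/-- If the `m`-torsion of `X` is Artinian for all maximal ideals `m` of a Noetherian ring, so is
its `I`-torsion for every product `I` of maximal ideals. -/
theorem Submodule.isArtinian_torsionBySet_of_mem_closure [IsNoetherianRing R]
    (hX : ∀ m : Ideal R, m.IsMaximal → IsArtinian R (torsionBySet R X m)) {I : Ideal R}
    (hI : I ∈ Submonoid.closure {m : Ideal R | m.IsMaximal}) :
    IsArtinian R (torsionBySet R X I) := by
  induction hI using Submonoid.closure_induction with
  | mem m hm => exact hX m hm
  | one =>
    have : torsionBySet R X ((1 : Ideal R) : Set R) = ⊥ := by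
      rw [eq_bot_iff]
      intro x hx
      simpa using (mem_torsionBySet_iff _ _).1 hx ⟨1, by simp⟩
    rw [this]
    infer_instance
  | mul I J _ _ _ _ => exact isArtinian_torsionBySet_mul (IsNoetherian.noetherian I)

/-- The elements of a module killed by a product of maximal ideals. -/
def Submodule.maximalTorsion (R : Type u) [CommRing R] (X : Type v) [AddCommMonoid X]
    [Module R X] : Submodule R X where
  carrier := {x | ∃ I ∈ Submonoid.closure {m : Ideal R | m.IsMaximal}, ∀ a ∈ I, a • x = 0}
  zero_mem' := ⟨1, one_mem _, fun a _ => smul_zero a⟩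
  add_mem' := by
    rintro x y ⟨I, hI, hx⟩ ⟨J, hJ, hy⟩
    refine ⟨I * J, mul_mem hI hJ, fun a ha => ?_⟩
    have haI : a ∈ I := (Ideal.mul_le_left : I * J ≤ I) ha
    have haJ : a ∈ J := (Ideal.mul_le_right : I * J ≤ J) ha
    rw [smul_add, hx a haI, hy a haJ, add_zero]
  smul_mem' := by
    rintro r x ⟨I, hI, hx⟩
    exact ⟨I, hI, fun a ha => by rw [smul_comm, hx a ha, smul_zero]⟩

/-- A module with Artinian `m`-torsion for all maximal ideals `m`, each of whose elements is
killed by a product of maximal ideals, is co-Hopfian. -/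
theorem IsCoHopfian.of_isArtinian_torsionBySet [IsNoetherianRing R]
    (hX : ∀ m : Ideal R, m.IsMaximal → IsArtinian R (Submodule.torsionBySet R X m))
    (hX' : Submodule.maximalTorsion R X = ⊤) : IsCoHopfian R X := by
  refine fun f hf => ⟨hf, fun x => ?_⟩
  obtain ⟨I, hI, hx⟩ : x ∈ Submodule.maximalTorsion R X := hX' ▸ Submodule.mem_top
  have := Submodule.isArtinian_torsionBySet_of_mem_closure hX hI
  have hmaps : ∀ y ∈ Submodule.torsionBySet R X I, f y ∈ Submodule.torsionBySet R X I := by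
    intro y hy
    rw [Submodule.mem_torsionBySet_iff] at hy ⊢
    intro a
    have := congrArg f (hy a)
    rwa [map_zero, map_smul] at this
  obtain ⟨y, hy⟩ := (IsArtinian.bijective_of_injective_endomorphism (f.restrict hmaps)
    fun y z hyz => Subtype.ext (hf (congrArg Subtype.val hyz))).2
      ⟨x, (Submodule.mem_torsionBySet_iff _ _).2 fun a => hx a a.2⟩
  exact ⟨y, congrArg Subtype.val hy⟩

/-- Supports are finite, so multiplying annihilators of the components gives one product of maximal
ideals. -/
theorem Submodule.maximalTorsion_directSum {ι : Type*} {N : ι → Type*} [∀ k, AddCommMonoid (N k)]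
    [∀ k, Module R (N k)] (hN : ∀ k, maximalTorsion R (N k) = ⊤) :
    maximalTorsion R (⨁ k, N k) = ⊤ := by
  classical
  rw [eq_top_iff]
  rintro x -
  induction x using DirectSum.induction_on with
  | zero => exact zero_mem _
  | of k y =>
    obtain ⟨I, hI, hy⟩ : y ∈ maximalTorsion R (N k) := hN k ▸ mem_top
    refine ⟨I, hI, fun a ha => ?_⟩
    change a • DirectSum.lof R ι N k y = 0
    rw [← map_smul, hy a ha, map_zero]
  | add x y hx hy => exact add_mem hx hy

end Torsion

/-- A module killed elementwise by products of maximal ideals is co-Hopfian if finitely many maps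
to each `E(R/m)` jointly separate its elements. -/
theorem IsCoHopfian.of_separating {R : Type u} [CommRing R] [IsNoetherianRing R] [Small.{v} R]
    {E : MaximalSpectrum R → Type v} [∀ m, AddCommGroup (E m)] [∀ m, Module R (E m)]
    {i : ∀ m : MaximalSpectrum R, (R ⧸ m.asIdeal) →ₗ[R] E m}
    (hE : ∀ m, IsInjectiveEnvelope R (i m)) {n : MaximalSpectrum R → ℕ}
    {X : Type*} [AddCommGroup X] [Module R X] (π : ∀ m, Fin (n m) → X →ₗ[R] E m)
    (hπ : ∀ x, (∀ m j, π m j x = 0) → x = 0) (hX : Submodule.maximalTorsion R X = ⊤) :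
    IsCoHopfian R X := by
  refine .of_isArtinian_torsionBySet (fun m hm => ?_) hX
  let m₀ : MaximalSpectrum R := ⟨m, hm⟩
  have hcomp : ∀ x : Submodule.torsionBySet R X (m : Set R), ∀ (p : MaximalSpectrum R)
      (j : Fin (n p)), ∀ a ∈ m, a • π p j x = 0 := by
    intro x p j a ha
    have : a • (x : X) = 0 := (Submodule.mem_torsionBySet_iff _ _).1 x.2 ⟨a, ha⟩
    rw [← map_smul, this, map_zero]
  have : IsSimpleModule R (R ⧸ m) := isSimpleModule_iff_isCoatom.2 hm.out
  have : IsArtinian R (LinearMap.range (i m₀)) :=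
    isArtinian_of_surjective _ (i m₀).rangeRestrict (i m₀).surjective_rangeRestrict
  -- Only the coordinates at `m` are kept: on `m`-torsion the others vanish, so `φ` is injective.
  -- Its target is Artinian because `n m₀` is finite.
  let φ : Submodule.torsionBySet R X (m : Set R) →ₗ[R] (Fin (n m₀) → LinearMap.range (i m₀)) :=
    LinearMap.pi fun j => LinearMap.codRestrict _ (π m₀ j ∘ₗ Submodule.subtype _)
      fun x => (hE m₀).mem_range_of_forall_smul_eq_zero (hcomp x m₀ j)
  refine isArtinian_of_injective φ ((injective_iff_map_eq_zero φ).2 fun x hx => ?_)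
  refine Subtype.ext (hπ x fun p j => ?_)
  by_cases hp : p = m₀
  · subst hp
    exact congrArg Subtype.val (congrFun hx j)
  · exact (hE p).eq_zero_of_forall_smul_eq_zero p.isMaximal hm
      (fun h => hp (MaximalSpectrum.ext h.symm)) (hcomp x p j)

theorem theorem1p3 (R : Type u) [CommRing R] [IsNoetherianRing R] [Small.{v} R]
    (E : MaximalSpectrum R → Type v) [∀ m, AddCommGroup (E m)] [∀ m, Module R (E m)]
    (i : ∀ m : MaximalSpectrum R, (R ⧸ m.asIdeal) →ₗ[R] E m)
    (hE : ∀ m, IsInjectiveEnvelope R (i m))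
    (n : MaximalSpectrum R → ℕ)
    (M : Submodule R (⨁ m : MaximalSpectrum R, ⨁ _ : Fin (n m), E m)) :
    IsCoHopfian R M := by
  have hE' : ∀ m, Submodule.maximalTorsion R (E m) = ⊤ := by
    intro m
    rw [eq_top_iff]
    rintro x -
    obtain ⟨k, hk⟩ := (hE m).exists_pow_smul_eq_zero x
    exact ⟨m.asIdeal ^ k, pow_mem (Submonoid.subset_closure m.isMaximal) k, hk⟩
  refine .of_separating hE (fun m j => DirectSum.component R _ _ j ∘ₗ
    DirectSum.component R _ (fun m => ⨁ _ : Fin (n m), E m) m ∘ₗ M.subtype) ?_ ?_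
  · exact fun x hx => Subtype.ext (DFinsupp.ext fun m => DFinsupp.ext fun j => hx m j)
  · rw [eq_top_iff]
    rintro x -
    have htop := Submodule.maximalTorsion_directSum
      fun m => Submodule.maximalTorsion_directSum fun _ : Fin (n m) => hE' m
    obtain ⟨I, hI, hx⟩ :
        (x : ⨁ m, ⨁ _ : Fin (n m), E m) ∈ Submodule.maximalTorsion R _ := htop ▸ Submodule.mem_top
    exact ⟨I, hI, fun a ha => Subtype.ext (hx a ha)⟩
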